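/- Let $G$ be a compact (Hausdorff) abelian group with normalized Haar measure $\nu$ and dual group $\widehat G$, and put $\widehat f(\gamma)=\int_G f\,\overline{\gamma}\,d\nu$. For a finite set $\Gamma\subset\widehat G$ let $C_\Gamma$ be the space of all $f\in C(G)$ (complex valued, sup norm) with $\widehat f(\gamma)=0$ for all $\gamma\notin\Gamma$. For $\xi=(\xi_\gamma)\in\mathbb C^\Gamma$ let $M_\xi\colon C_\Gamma\to\ell_1(\Gamma)$, $M_\xi f=(\xi_\gamma\widehat f(\gamma))_{\gamma\in\Gamma}$. For $1\le\lambda<\infty$, a $\lambda$-embedding is an isomorphic embedding $I$ of Banach spaces with $\|I\|\,\|I^{-1}\|\le\lambda$, where $I^{-1}$ is defined on the range of $I$. An interpolation functor $\mathcal F$ assigns to each complex Banach couple $\vec X=(X_0,X_1)$ a Banach space $\mathcal F(\vec X)$ with continuous inclusions $X_0\cap X_1\subset\mathcal F(\vec X)\subset X_0+X_1$, such that every operator $T\colon\vec X\to\vec Y$ of couples (a linear map $X_0+X_1\to Y_0+Y_1$ whose restrictions $X_j\to Y_j$, $j=0,1$, are defined and bounded) maps $\mathcal F(\vec X)$ boundedly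 into $\mathcal F(\vec Y)$. It is exact if always $\|T\colon\mathcal F(\vec X)\to\mathcal F(\vec Y)\|\le\max_{j=0,1}\|T\colon X_j\to Y_j\|$, and normalized if $\|1\|_{\mathcal F(\mathbb C,\mathbb C)}\le1$. Its fundamental function $\psi_{\mathcal F}(s,t)$, $s,t\ge0$, is the supremum of $\|T\colon\mathcal F(\vec X)\to\mathcal F(\vec Y)\|$ over all Banach couples $\vec X,\vec Y$ and all operators $T\colon\vec X\to\vec Y$ with $\|T\colon X_0\to Y_0\|\le s$ and $\|T\colon X_1\to Y_1\|\le t$. (a) Let $I\colon C_\Gamma\to\ell_\infty^N$ be a $\lambda$-embedding, let $\mathcal F$ be a normalized exact interpolation functor, and let $X=\mathcal F(\ell_1(\Gamma),\ell_2(\Gamma))$. Then for every $\xi\in\mathbb C^\Gamma$ $$\sup_{\|\mu\|_{\ell_2(\Gamma)}\le1}\|(\xi_\gamma\mu_\gamma)_{\gamma\in\Gamma}\|_X\le K\,\psi_{\mathcal F}\big(\|M_\xi\colon C_\Gamma\to\ell_1(\Gamma)\|,\|\xi\|_{\ell_\infty(\Gamma)}\big)\,\psi_{\mathcal F}\big(\sqrt{1+\log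 N},1\big),\qquad K=e^2\lambda\sqrt2\,\psi_{\mathcal F}(1,1).$$ (b) Let $I\colon C_\Gamma\to\ell_\infty^N$ be a $\lambda$-embedding, $\theta\in(0,1)$ and $\frac1{p_\theta}=(1-\theta)+\frac\theta2$. Then for every $\xi\in\mathbb C^\Gamma$ $$\sup_{\|\mu\|_{\ell_2(\Gamma)}\le1}\|(\xi_\gamma\mu_\gamma)\|_{\ell_{p_\theta}(\Gamma)}\le e^2\lambda\sqrt2\,\big(\sqrt{1+\log N}\,\|M_\xi\colon C_\Gamma\to\ell_1(\Gamma)\|\big)^{1-\theta}\|\xi\|_\infty^\theta.$$ (c) Let $m,n\ge1$, let $\Lambda$ be the set of all $\alpha\in\mathbb N_0^n$ with $|\alpha|=\alpha_1+\dots+\alpha_n\le m$, identified with the set of characters $z\mapsto z^\alpha$ of the torus $\mathbb T^n$, so that $\mathcal P_{\le m}(\mathbb T^n):=C_\Lambda$ is the space of analytic polynomials of degree at most $m$ in $n$ variables with the sup norm on $\mathbb T^n$. Then for every $\xi\in\mathbb C^\Lambda$ and $\theta\in(0,1)$, $\frac1{p_\theta}=(1-\theta)+\frac\theta2$, $$\sup_{\|\mu\|_{\ell_2(\Lambda)}\le1}\|(\mu_\alpha\xi_\alpha)\|_{\ell_{p_\theta}(\Lambda)}\le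 2e^2\sqrt2\,\big(\sqrt{n\log(1+20m)}\,\|M_\xi\colon\mathcal P_{\le m}(\mathbb T^n)\to\ell_1(\Lambda)\|\big)^{1-\theta}\|\xi\|_\infty^\theta,$$ and $$\sup_{\|\mu\|_{\ell_2(\Lambda)}\le1}\|(\mu_\alpha\xi_\alpha)\|_{\ell_{\frac{2m}{m+1}}(\Lambda)}\le 2e^2\sqrt2\,\big(\sqrt{n\log(1+20m)}\,\|M_\xi\colon\mathcal P_{\le m}(\mathbb T^n)\to\ell_1(\Lambda)\|\big)^{\frac1m}\|\xi\|_\infty^{1-\frac1m}.$$ -/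

import Mathlib

open MeasureTheory

universe u

/-! ### Banach couples, interpolation functors and their fundamental functions -/

/-- A complex Banach space `B` with `B ↪ V`: the inclusion is an injective continuous linear map. -/
structure BanachSubspace (V : Type u) [AddCommGroup V] [Module ℂ V] [TopologicalSpace V] where
  carrier : Type u
  [normedAddCommGroup : NormedAddCommGroup carrier]
  [normedSpace : NormedSpace ℂ carrier]
  [completeSpace : CompleteSpace carrier]
  incl : carrier →L[ℂ] V
  incl_injective : Function.Injective incl

attribute [instance] BanachSubspace.normedAddCommGroup BanachSubspace.normedSpace
  BanachSubspace.completeSpace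

section BanachSubspace

variable {V W : Type u} [AddCommGroup V] [Module ℂ V] [TopologicalSpace V]
  [AddCommGroup W] [Module ℂ W] [TopologicalSpace W]

/-- `v ∈ B` and `‖v‖_B ≤ c`. -/
def BanachSubspace.NormLE (B : BanachSubspace V) (v : V) (c : ℝ) : Prop :=
  ∃ x : B.carrier, B.incl x = v ∧ ‖x‖ ≤ c

/-- `T` maps `A` (a subspace of the domain `S` of `T`) into `B`, and `‖T x‖_B ≤ c ‖x‖_A`
for all `x ∈ A`. -/
def BoundedBy {S : Submodule ℂ V} {S' : Submodule ℂ W} (T : S →ₗ[ℂ] S')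
    (A : BanachSubspace V) (B : BanachSubspace W) (c : ℝ) : Prop :=
  ∀ (x : A.carrier) (hx : A.incl x ∈ S), B.NormLE (T ⟨A.incl x, hx⟩ : W) (c * ‖x‖)

/-- The operator norm `‖T : A → B‖`, for `T` bounded from `A` to `B`. -/
noncomputable def operatorNorm {S : Submodule ℂ V} {S' : Submodule ℂ W} (T : S →ₗ[ℂ] S')
    (A : BanachSubspace V) (B : BanachSubspace W) : ℝ :=
  sInf {c : ℝ | 0 ≤ c ∧ BoundedBy T A B c}

end BanachSubspace

/-- A Banach couple: two Banach spaces continuously included in one Hausdorff topological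
vector space. -/
structure BanachCouple where
  ambient : Type u
  [addCommGroup : AddCommGroup ambient]
  [module : Module ℂ ambient]
  [topologicalSpace : TopologicalSpace ambient]
  [isTopologicalAddGroup : IsTopologicalAddGroup ambient]
  [continuousSMul : ContinuousSMul ℂ ambient]
  [t2Space : T2Space ambient]
  X₀ : BanachSubspace ambient
  X₁ : BanachSubspace ambient

attribute [instance] BanachCouple.addCommGroup BanachCouple.module
  BanachCouple.topologicalSpace BanachCouple.isTopologicalAddGroup
  BanachCouple.continuousSMul BanachCouple.t2Space

/-- The algebraic sum `X₀ + X₁`. -/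
def BanachCouple.sum (X : BanachCouple.{u}) : Submodule ℂ X.ambient :=
  LinearMap.range (X.X₀.incl : X.X₀.carrier →ₗ[ℂ] X.ambient) ⊔
    LinearMap.range (X.X₁.incl : X.X₁.carrier →ₗ[ℂ] X.ambient)

/-- An operator between Banach couples: a linear map `X₀ + X₁ → Y₀ + Y₁` whose restrictions
`X_j → Y_j` are defined and bounded. -/
structure CoupleOperator (X Y : BanachCouple.{u}) where
  toLinearMap : X.sum →ₗ[ℂ] Y.sum
  bounded₀ : ∃ c, BoundedBy toLinearMap X.X₀ Y.X₀ c
  bounded₁ : ∃ c, BoundedBy toLinearMap X.X₁ Y.X₁ c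

namespace CoupleOperator

variable {X Y : BanachCouple.{u}}

/-- `‖T : X₀ → Y₀‖`. -/
noncomputable def norm₀ (T : CoupleOperator X Y) : ℝ :=
  operatorNorm T.toLinearMap X.X₀ Y.X₀

/-- `‖T : X₁ → Y₁‖`. -/
noncomputable def norm₁ (T : CoupleOperator X Y) : ℝ :=
  operatorNorm T.toLinearMap X.X₁ Y.X₁

end CoupleOperator

/-- An interpolation functor on the class of all complex Banach couples. The fields `inter_le`
and `le_sum` are the continuous inclusions `X₀ ∩ X₁ ↪ F(X) ↪ X₀ + X₁`, for the norms
`max ‖x‖₀ ‖x‖₁` on the intersection and `inf (‖x₀‖ + ‖x₁‖)` on the sum. -/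
structure InterpolationFunctor where
  obj : ∀ X : BanachCouple.{u}, BanachSubspace X.ambient
  inter_le : ∀ X : BanachCouple.{u}, ∃ C : ℝ, ∀ (x₀ : X.X₀.carrier) (x₁ : X.X₁.carrier),
    X.X₀.incl x₀ = X.X₁.incl x₁ → (obj X).NormLE (X.X₀.incl x₀) (C * max ‖x₀‖ ‖x₁‖)
  le_sum : ∀ X : BanachCouple.{u}, ∃ C : ℝ, ∀ x : (obj X).carrier,
    ∃ (x₀ : X.X₀.carrier) (x₁ : X.X₁.carrier),
      (obj X).incl x = X.X₀.incl x₀ + X.X₁.incl x₁ ∧ ‖x₀‖ + ‖x₁‖ ≤ C * ‖x‖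
  bounded : ∀ (X Y : BanachCouple.{u}) (T : CoupleOperator X Y),
    ∃ c, BoundedBy T.toLinearMap (obj X) (obj Y) c

/-- The couple `(ℂ, ℂ)`. -/
noncomputable def scalarCouple : BanachCouple.{u} where
  ambient := ULift.{u} ℂ
  X₀ := ⟨ULift.{u} ℂ, .id ℂ _, Function.injective_id⟩
  X₁ := ⟨ULift.{u} ℂ, .id ℂ _, Function.injective_id⟩

namespace InterpolationFunctor

/-- `‖T : F(X) → F(Y)‖`. -/
noncomputable def mapNorm (F : InterpolationFunctor.{u}) {X Y : BanachCouple.{u}}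
    (T : CoupleOperator X Y) : ℝ :=
  operatorNorm T.toLinearMap (F.obj X) (F.obj Y)

/-- `F` is exact: `‖T : F(X) → F(Y)‖ ≤ max (‖T : X₀ → Y₀‖) (‖T : X₁ → Y₁‖)`. -/
def IsExact (F : InterpolationFunctor.{u}) : Prop :=
  ∀ (X Y : BanachCouple.{u}) (T : CoupleOperator X Y), F.mapNorm T ≤ max T.norm₀ T.norm₁

/-- `F` is normalized: the unit `1 ∈ ℂ` has norm at most one in `F(ℂ, ℂ)`. -/
def IsNormalized (F : InterpolationFunctor.{u}) : Prop :=
  (F.obj scalarCouple.{u}).NormLE (ULift.up (1 : ℂ) : ULift.{u} ℂ) 1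

/-- The fundamental function `ψ_F(s, t)`: the supremum of `‖T : F(X) → F(Y)‖` over all
operators `T` between Banach couples with `‖T : X₀ → Y₀‖ ≤ s` and `‖T : X₁ → Y₁‖ ≤ t`. For exact
`F` and `s, t ≥ 0` these norms are bounded by `max s t`. -/
noncomputable def fundamentalFunction (F : InterpolationFunctor.{u}) (s t : ℝ) : ℝ :=
  sSup {r : ℝ | ∃ (X Y : BanachCouple.{u}) (T : CoupleOperator X Y),
    T.norm₀ ≤ s ∧ T.norm₁ ≤ t ∧ r = F.mapNorm T}

end InterpolationFunctor

/-- The couple `(ℓ₁(ι), ℓ₂(ι))` for a finite index set `ι`, inside `ℂ^ι`. -/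
noncomputable def l1l2Couple (ι : Type u) [Fintype ι] : BanachCouple.{u} where
  ambient := ι → ℂ
  X₀ := ⟨PiLp 1 (fun _ : ι => ℂ), (PiLp.continuousLinearEquiv 1 ℂ (fun _ : ι => ℂ)),
    (PiLp.continuousLinearEquiv 1 ℂ (fun _ : ι => ℂ)).injective⟩
  X₁ := ⟨PiLp 2 (fun _ : ι => ℂ), (PiLp.continuousLinearEquiv 2 ℂ (fun _ : ι => ℂ)),
    (PiLp.continuousLinearEquiv 2 ℂ (fun _ : ι => ℂ)).injective⟩

/-- `v ↦ (∑ |v i| ^ p) ^ (1 / p)`. -/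
noncomputable def finiteLpNorm {ι : Type*} [Fintype ι] (p : ℝ) (v : ι → ℂ) : ℝ :=
  (∑ i, ‖v i‖ ^ p) ^ (1 / p)

/-! ### `λ`-embeddings -/

/-- `T` is a `λ`-embedding: an isomorphic embedding with `‖T‖ ‖T⁻¹‖ ≤ λ`, where `1 ≤ λ < ∞`
and `T⁻¹` is defined on the range of `T`; here `‖T⁻¹‖` is the least `K` such that
`‖x‖ ≤ K ‖T x‖` for all `x`. -/
def IsLambdaEmbedding {E E' : Type*} [NormedAddCommGroup E] [NormedSpace ℂ E]
    [NormedAddCommGroup E'] [NormedSpace ℂ E'] (lam : ℝ) (T : E →L[ℂ] E') : Prop :=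
  1 ≤ lam ∧ ∃ K : ℝ, 0 ≤ K ∧ (∀ x, ‖x‖ ≤ K * ‖T x‖) ∧ ‖T‖ * K ≤ lam

/-! ### Harmonic analysis on a compact abelian group -/

section CompactGroup

variable {G : Type*} [CommGroup G] [TopologicalSpace G] [IsTopologicalGroup G]
  [CompactSpace G] [MeasurableSpace G] [BorelSpace G]

variable (G) in
/-- The normalized Haar measure on a compact group. -/
noncomputable def normalizedHaar : Measure G :=
  Measure.haarMeasure (⊤ : TopologicalSpace.PositiveCompacts G)

instance : IsProbabilityMeasure (normalizedHaar G) :=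
  ⟨by simpa [normalizedHaar] using
    Measure.haarMeasure_self (K₀ := (⊤ : TopologicalSpace.PositiveCompacts G))⟩

theorem integrable_mul_conj_character (f : C(G, ℂ)) (γ : PontryaginDual G) :
    Integrable (fun g => f g * (starRingEnd ℂ) (γ g : ℂ)) (normalizedHaar G) := by
  refine Continuous.integrable_of_hasCompactSupport ?_ (HasCompactSupport.of_compactSpace _)
  have h : Continuous (fun g => (γ g : ℂ)) := by
    have : Continuous γ := map_continuous γ
    fun_prop
  have h2 : Continuous (fun g => (starRingEnd ℂ) (γ g : ℂ)) := Complex.continuous_conj.comp h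
  fun_prop

/-- The Fourier coefficient `f ↦ f̂(γ) = ∫ f(g) conj(γ(g)) dν(g)` on `C(G)`. -/
noncomputable def fourierCoefficient (γ : PontryaginDual G) : C(G, ℂ) →L[ℂ] ℂ :=
  LinearMap.mkContinuous
    { toFun := fun f => ∫ g, f g * (starRingEnd ℂ) (γ g : ℂ) ∂(normalizedHaar G)
      map_add' := fun f₁ f₂ => by
        rw [← integral_add (integrable_mul_conj_character f₁ γ)
          (integrable_mul_conj_character f₂ γ)]
        simp only [ContinuousMap.add_apply, add_mul]
      map_smul' := fun c f => by
        simp only [ContinuousMap.smul_apply, smul_eq_mul, mul_assoc, RingHom.id_apply]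
        exact integral_const_mul c _ }
    1 (fun f => by
      refine (norm_integral_le_of_norm_le_const (C := 1 * ‖f‖)
        (Filter.Eventually.of_forall fun g => ?_)).trans (by simp)
      have h : ‖(γ g : ℂ)‖ = 1 := Circle.norm_coe (γ g)
      rw [norm_mul, RCLike.norm_conj, h, mul_one, one_mul]
      exact f.norm_coe_le_norm g)

/-- `C_Γ`: the continuous functions on `G` whose Fourier coefficients vanish outside `Γ`, with
the sup norm. -/
noncomputable def spectralSubspace (Γ : Finset (PontryaginDual G)) : Submodule ℂ C(G, ℂ) where
  carrier := {f | ∀ γ, γ ∉ Γ → fourierCoefficient γ f = 0}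
  add_mem' := fun {f₁ f₂} h₁ h₂ γ hγ => by rw [map_add, h₁ γ hγ, h₂ γ hγ, add_zero]
  zero_mem' := fun γ _ => map_zero _
  smul_mem' := fun c f h γ hγ => by rw [map_smul, h γ hγ, smul_zero]

/-- The multiplier `M_ξ : C_Γ → ℓ₁(Γ)`, `f ↦ (ξ_γ f̂(γ))_{γ ∈ Γ}`. -/
noncomputable def multiplier (Γ : Finset (PontryaginDual G)) (ξ : Γ → ℂ) :
    spectralSubspace Γ →L[ℂ] PiLp 1 (fun _ : Γ => ℂ) :=
  ((PiLp.continuousLinearEquiv 1 ℂ (fun _ : Γ => ℂ)).symm :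
      (Γ → ℂ) →L[ℂ] PiLp 1 (fun _ : Γ => ℂ)).comp
    (ContinuousLinearMap.pi fun γ : Γ =>
      ξ γ • (fourierCoefficient (γ : PontryaginDual G)).comp (spectralSubspace Γ).subtypeL)

end CompactGroup

/-! ### Analytic polynomials on the torus -/

/-- The character `z ↦ z ^ α` of the torus `𝕋ⁿ`. -/
noncomputable def monomialCharacter {n : ℕ} (α : Fin n → ℕ) :
    PontryaginDual (Fin n → Circle) :=
  ({ toFun := fun z => ∏ i, z i ^ α i
     map_one' := by simp
     map_mul' := fun z w => by simp [mul_pow, Finset.prod_mul_distrib]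
     continuous_toFun := by fun_prop } : (Fin n → Circle) →ₜ* Circle)

open Classical in
/-- `Λ^≤(m, n)`: the characters `z ^ α` of `𝕋ⁿ` with `α ∈ ℕ₀ⁿ`, `|α| ≤ m`. The space
`spectralSubspace (analyticSpectrum m n)` consists of the analytic polynomials of degree at most
`m` in `n` variables. -/
noncomputable def analyticSpectrum (m n : ℕ) : Finset (PontryaginDual (Fin n → Circle)) :=
  ((Fintype.piFinset fun _ : Fin n => Finset.range (m + 1)).filter
    (fun α => ∑ i, α i ≤ m)).image monomialCharacter

/-!
A random choice of signs makes every finite family of functionals small on `∑ γ, ε γ * μ γ • γ`: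
if finitely many functionals norm `C_Γ` up to a constant, the sup norm of this polynomial is at most
`‖μ‖₂` times the square root of the logarithm of their number. Since `M_ξ` does not see the signs,
multiplication by `ξ` then maps `ℓ₂(Γ)` to `ℓ₁(Γ)` with norm `≲ √(1 + log N) ‖M_ξ‖`, while it maps
`ℓ₂(Γ)` to itself with norm `‖ξ‖_∞`. Hölder's inequality interpolates between the two. For an
interpolation functor the orbit of `μ` is factored as `(ℂ, ℂ) → (s ℓ₂, ℓ₂) → (ℓ₁, ℓ₂)` with
`s = √(1 + log N)`, which separates the two fundamental functions.

On the torus the norming functionals are evaluations on a grid of `(1 + 20 m) ^ (2 n)` points.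
By the maximum principle a polynomial of degree `m` grows by at most a factor `e` on the polydisc
of radius `1 + 1 / m`, and the Schwarz lemma turns this into a Lipschitz bound of order `m`.
-/

/-! ### Random signs -/

section RandomSigns

variable {ι κ : Type*} [Fintype ι] [Fintype κ]

theorem sum_signs_exp_le [DecidableEq ι] (x : ι → ℝ) :
    ∑ ε : ι → ℤˣ, Real.exp (∑ i, (ε i : ℤ) * x i) ≤
      2 ^ Fintype.card ι * Real.exp ((∑ i, x i ^ 2) / 2) := by
  have hcosh (y : ℝ) : ∑ e : ℤˣ, Real.exp ((e : ℤ) * y) = 2 * Real.cosh y := by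
    rw [UnitsInt.univ, Finset.sum_pair (by decide), Real.cosh_eq]
    simp only [Units.val_one, Units.val_neg, Int.cast_neg, Int.cast_one, one_mul, neg_one_mul]
    ring
  calc ∑ ε : ι → ℤˣ, Real.exp (∑ i, (ε i : ℤ) * x i)
      = ∏ i, 2 * Real.cosh (x i) := by
        simp only [Real.exp_sum, ← hcosh, Fintype.prod_sum]
    _ ≤ ∏ i, 2 * Real.exp (x i ^ 2 / 2) := by
        gcongr with i
        exact Real.cosh_le_exp_half_sq _
    _ = 2 ^ Fintype.card ι * Real.exp ((∑ i, x i ^ 2) / 2) := by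
        rw [Finset.prod_mul_distrib, ← Real.exp_sum, Finset.sum_div, Finset.prod_const,
          Finset.card_univ]

theorem exists_signs_sum_exp_abs_le (x : κ → ι → ℝ) {b : ℝ} (hx : ∀ k, ∑ i, x k i ^ 2 ≤ b) :
    ∃ ε : ι → ℤˣ, ∑ k, Real.exp |∑ i, (ε i : ℤ) * x k i| ≤
      2 * Fintype.card κ * Real.exp (b / 2) := by
  classical
  have hmean : ∑ ε : ι → ℤˣ, ∑ k, Real.exp |∑ i, (ε i : ℤ) * x k i| ≤
      ∑ _ε : ι → ℤˣ, 2 * Fintype.card κ * Real.exp (b / 2) := by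
    calc ∑ ε : ι → ℤˣ, ∑ k, Real.exp |∑ i, (ε i : ℤ) * x k i|
        ≤ ∑ ε : ι → ℤˣ, ∑ k, (Real.exp (∑ i, (ε i : ℤ) * x k i) +
            Real.exp (∑ i, (ε i : ℤ) * -x k i)) := by
          gcongr
          simpa only [mul_neg, Finset.sum_neg_distrib] using Real.exp_abs_le _
      _ ≤ ∑ _k : κ, (2 ^ Fintype.card ι * Real.exp (b / 2) +
            2 ^ Fintype.card ι * Real.exp (b / 2)) := by
          rw [Finset.sum_comm]
          simp only [Finset.sum_add_distrib (ι := ι → ℤˣ)]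
          gcongr with k
          · exact (sum_signs_exp_le _).trans (by gcongr; exact hx k)
          · exact (sum_signs_exp_le _).trans (by gcongr; simpa only [neg_sq] using hx k)
      _ = ∑ _ε : ι → ℤˣ, 2 * Fintype.card κ * Real.exp (b / 2) := by
          simp only [Finset.sum_const, Finset.card_univ, Fintype.card_pi, Fintype.card_units_int,
            Finset.prod_const, nsmul_eq_mul, Nat.cast_pow, Nat.cast_ofNat]
          ring
  obtain ⟨ε, -, hε⟩ := Finset.exists_le_of_sum_le Finset.univ_nonempty hmean
  exact ⟨ε, hε⟩

theorem exists_signs_abs_sum_le (x : κ → ι → ℝ) {σ : ℝ} (hσ : 0 ≤ σ)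
    (hx : ∀ k, ∑ i, x k i ^ 2 ≤ σ ^ 2) :
    ∃ ε : ι → ℤˣ, ∀ k, |∑ i, (ε i : ℤ) * x k i| ≤ σ * √(2 * Real.log (2 * Fintype.card κ)) := by
  cases isEmpty_or_nonempty κ
  · exact ⟨1, isEmptyElim⟩
  rcases hσ.eq_or_lt with rfl | hσ
  · refine ⟨1, fun k => ?_⟩
    have hk : ∑ i, x k i ^ 2 = 0 :=
      le_antisymm (by simpa using hx k) (Finset.sum_nonneg fun i _ => sq_nonneg _)
    have hxk : ∀ i, x k i = 0 := by
      simpa [Finset.sum_eq_zero_iff_of_nonneg fun _ _ => sq_nonneg _] using hk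
    simp [hxk]
  set L : ℝ := Real.log (2 * Fintype.card κ) with hL
  have hcard : (1 : ℝ) ≤ Fintype.card κ := by exact_mod_cast Fintype.card_pos
  have hLpos : 0 < L := Real.log_pos (by linarith)
  -- The parameter `t` balances the two terms of `L + (t * σ) ^ 2 / 2`.
  set t : ℝ := √(2 * L) / σ with ht
  have htσ : (t * σ) ^ 2 = 2 * L := by
    rw [ht, div_mul_cancel₀ _ hσ.ne', Real.sq_sqrt (by positivity)]
  obtain ⟨ε, hε⟩ := exists_signs_sum_exp_abs_le (fun k i => t * x k i) (b := (t * σ) ^ 2)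
    fun k => by
      simp only [mul_pow, ← Finset.mul_sum]
      gcongr
      exact hx k
  refine ⟨ε, fun k => ?_⟩
  have hexp : Real.exp (t * |∑ i, (ε i : ℤ) * x k i|) ≤ Real.exp (L + (t * σ) ^ 2 / 2) := by
    calc Real.exp (t * |∑ i, (ε i : ℤ) * x k i|)
        = Real.exp |∑ i, (ε i : ℤ) * (t * x k i)| := by
          simp only [mul_left_comm _ t, ← Finset.mul_sum]
          rw [abs_mul, abs_of_nonneg (by positivity : 0 ≤ t)]
      _ ≤ ∑ k, Real.exp |∑ i, (ε i : ℤ) * (t * x k i)| :=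
          Finset.single_le_sum (f := fun k => Real.exp |∑ i, (ε i : ℤ) * (t * x k i)|)
            (fun _ _ => (Real.exp_pos _).le) (Finset.mem_univ k)
      _ ≤ Real.exp (L + (t * σ) ^ 2 / 2) := by
          rwa [Real.exp_add, hL, Real.exp_log (by positivity)]
  have hsq : √(2 * L) * √(2 * L) = 2 * L := Real.mul_self_sqrt (by positivity)
  rw [Real.exp_le_exp, htσ, ht, div_mul_eq_mul_div, div_le_iff₀ hσ] at hexp
  refine le_of_mul_le_mul_left ?_ (Real.sqrt_pos.2 (by positivity : 0 < 2 * L))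
  linear_combination hexp - σ * hsq

theorem exists_signs_norm_sum_le (a : κ → ι → ℂ) {σ : ℝ} (hσ : 0 ≤ σ)
    (ha : ∀ k, ∑ i, ‖a k i‖ ^ 2 ≤ σ ^ 2) :
    ∃ ε : ι → ℤˣ, ∀ k, ‖∑ i, (ε i : ℤ) * a k i‖ ≤
      2 * σ * √(Real.log (4 * Fintype.card κ)) := by
  obtain ⟨ε, hε⟩ := exists_signs_abs_sum_le
    (Sum.elim (fun k i => (a k i).re) (fun k i => (a k i).im)) hσ (by
      rintro (k | k)
      · refine (Finset.sum_le_sum fun i _ => ?_).trans (ha k)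
        exact sq_le_sq.2 ((Complex.abs_re_le_norm _).trans (le_abs_self _))
      · refine (Finset.sum_le_sum fun i _ => ?_).trans (ha k)
        exact sq_le_sq.2 ((Complex.abs_im_le_norm _).trans (le_abs_self _)))
  refine ⟨ε, fun k => ?_⟩
  have hre := hε (.inl k)
  have him := hε (.inr k)
  have hcard : 2 * (Fintype.card (κ ⊕ κ) : ℝ) = 4 * Fintype.card κ := by
    rw [Fintype.card_sum]
    push_cast
    ring
  rw [hcard] at hre him
  calc ‖∑ i, ((ε i : ℤ) : ℂ) * a k i‖
      ≤ √2 * max |∑ i, ((ε i : ℤ) : ℝ) * (a k i).re| |∑ i, ((ε i : ℤ) : ℝ) * (a k i).im| := by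
        simpa using Complex.norm_le_sqrt_two_mul_max (∑ i, ((ε i : ℤ) : ℂ) * a k i)
    _ ≤ √2 * (σ * √(2 * Real.log (4 * Fintype.card κ))) := by
        gcongr
        exact max_le hre him
    _ = 2 * σ * √(Real.log (4 * Fintype.card κ)) := by
        rw [Real.sqrt_mul zero_le_two]
        linear_combination (σ * √(Real.log (4 * Fintype.card κ))) * Real.mul_self_sqrt zero_le_two

theorem exists_signs_norm_sum_smul_le {E : Type*} [SeminormedAddCommGroup E] [Module ℂ E]
    {x : ι → E} {y : ι → κ → ℂ} {A C : ℝ} (hA : 0 ≤ A) (hC : 0 ≤ C) (hy : ∀ i, ‖y i‖ ≤ A)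
    (hxy : ∀ c : ι → ℂ, ‖∑ i, c i • x i‖ ≤ C * ‖∑ i, c i • y i‖) (μ : EuclideanSpace ℂ ι) :
    ∃ ε : ι → ℤˣ, ‖∑ i, ((ε i : ℤ) * μ i : ℂ) • x i‖ ≤
      C * (2 * (A * ‖μ‖) * √(Real.log (4 * Fintype.card κ))) := by
  obtain ⟨ε, hε⟩ := exists_signs_norm_sum_le (fun k i => μ i * y i k)
    (σ := A * ‖μ‖) (by positivity) fun k => by
      rw [mul_pow, EuclideanSpace.norm_sq_eq, Finset.mul_sum]
      gcongr with i
      rw [norm_mul, mul_pow, mul_comm]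
      gcongr
      exact (norm_le_pi_norm _ k).trans (hy i)
  refine ⟨ε, (hxy _).trans ?_⟩
  gcongr
  refine (pi_norm_le_iff_of_nonneg (by positivity)).2 fun k => ?_
  simpa [mul_assoc] using hε k

end RandomSigns

/-! ### Norms on finite sequences -/

section FiniteLp

variable {ι : Type*} [Fintype ι]

theorem finiteLpNorm_one (v : ι → ℂ) : finiteLpNorm 1 v = ∑ i, ‖v i‖ := by
  simp [finiteLpNorm]

theorem finiteLpNorm_two (v : ι → ℂ) : finiteLpNorm 2 v = ‖WithLp.toLp 2 v‖ := by
  simp [finiteLpNorm, EuclideanSpace.norm_eq, Real.sqrt_eq_rpow]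

theorem finiteLpNorm_le_rpow_mul_rpow (v : ι → ℂ) {θ p p₀ p₁ : ℝ} (hp₀ : 0 < p₀) (hp₁ : 0 < p₁)
    (hθ₀ : 0 ≤ θ) (hθ₁ : θ ≤ 1) (hp : 1 / p = (1 - θ) / p₀ + θ / p₁) :
    finiteLpNorm p v ≤ finiteLpNorm p₀ v ^ (1 - θ) * finiteLpNorm p₁ v ^ θ := by
  rcases hθ₀.eq_or_lt with rfl | hθ₀
  · obtain rfl : p = p₀ := by simpa using hp
    simp
  rcases hθ₁.eq_or_lt with rfl | hθ₁
  · obtain rfl : p = p₁ := by simpa using hp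
    simp
  have hθ : 0 < 1 - θ := sub_pos.2 hθ₁
  have hp_pos : 0 < p := one_div_pos.1 (by rw [hp]; positivity)
  have hsum (q : ℝ) : 0 ≤ ∑ i, ‖v i‖ ^ q :=
    Finset.sum_nonneg fun _ _ => Real.rpow_nonneg (norm_nonneg _) _
  have hholder : (p₀ / (1 - θ)).HolderTriple (p₁ / θ) p :=
    ⟨by simpa using hp.symm, by positivity, by positivity⟩
  have hH := Real.Lr_rpow_le_Lp_mul_Lq_of_nonneg Finset.univ hholder
    (f := fun i => ‖v i‖ ^ (1 - θ)) (g := fun i => ‖v i‖ ^ θ)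
    (fun _ _ => by positivity) (fun _ _ => by positivity)
  have hmul (i : ι) : ‖v i‖ ^ (1 - θ) * ‖v i‖ ^ θ = ‖v i‖ := by
    rw [← Real.rpow_add_of_nonneg (norm_nonneg _) hθ.le hθ₀.le, sub_add_cancel, Real.rpow_one]
  simp only [hmul, ← Real.rpow_mul (norm_nonneg _), mul_div_cancel₀ _ hθ.ne',
    mul_div_cancel₀ _ hθ₀.ne'] at hH
  calc finiteLpNorm p v
      ≤ ((∑ i, ‖v i‖ ^ p₀) ^ (p / (p₀ / (1 - θ))) * (∑ i, ‖v i‖ ^ p₁) ^ (p / (p₁ / θ))) ^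
          (1 / p) := Real.rpow_le_rpow (hsum p) hH (by positivity)
    _ = finiteLpNorm p₀ v ^ (1 - θ) * finiteLpNorm p₁ v ^ θ := by
        rw [Real.mul_rpow (Real.rpow_nonneg (hsum _) _) (Real.rpow_nonneg (hsum _) _)]
        simp only [finiteLpNorm, ← Real.rpow_mul (hsum _)]
        congr 2 <;> field_simp

theorem norm_toLp_two_mul_le (ξ x : ι → ℂ) :
    ‖WithLp.toLp 2 fun i => ξ i * x i‖ ≤ ‖ξ‖ * ‖WithLp.toLp 2 x‖ := by
  refine le_of_sq_le_sq ?_ (by positivity)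
  rw [mul_pow, EuclideanSpace.norm_sq_eq, EuclideanSpace.norm_sq_eq, Finset.mul_sum]
  gcongr with i
  rw [norm_mul, mul_pow]
  gcongr
  exact norm_le_pi_norm ξ i

theorem finiteLpNorm_mul_le (ξ : ι → ℂ) {μ : EuclideanSpace ℂ ι} (hμ : ‖μ‖ ≤ 1)
    {C R θ p : ℝ} (hC : 1 ≤ C) (hR : 0 ≤ R) (h : ∑ i, ‖ξ i * μ i‖ ≤ C * R)
    (hθ₀ : 0 ≤ θ) (hθ₁ : θ ≤ 1) (hp : 1 / p = (1 - θ) + θ / 2) :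
    finiteLpNorm p (fun i => ξ i * μ i) ≤ C * R ^ (1 - θ) * ‖ξ‖ ^ θ := by
  have hC₀ : 0 ≤ C := zero_le_one.trans hC
  calc finiteLpNorm p (fun i => ξ i * μ i)
      ≤ finiteLpNorm 1 (fun i => ξ i * μ i) ^ (1 - θ) *
          finiteLpNorm 2 (fun i => ξ i * μ i) ^ θ :=
        finiteLpNorm_le_rpow_mul_rpow _ one_pos two_pos hθ₀ hθ₁ (by rw [hp, div_one])
    _ ≤ (C * R) ^ (1 - θ) * ‖ξ‖ ^ θ := by
        rw [finiteLpNorm_one, finiteLpNorm_two]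
        gcongr
        exact (norm_toLp_two_mul_le ξ μ).trans (mul_le_of_le_one_right (norm_nonneg _) hμ)
    _ ≤ C * R ^ (1 - θ) * ‖ξ‖ ^ θ := by
        rw [Real.mul_rpow hC₀ hR]
        gcongr
        exact Real.rpow_le_self_of_one_le hC (sub_le_self 1 hθ₀)

end FiniteLp

/-! ### Polynomials on the polydisc -/

section Polydisc

theorem norm_le_of_forall_mem_distinguishedBoundary {ι E : Type*} [Finite ι]
    [NormedAddCommGroup E] [NormedSpace ℂ E] {f : (ι → ℂ) → E} (hf : Differentiable ℂ f)
    {r : ι → ℝ} (hr : ∀ i, 0 < r i) {B : ℝ} (hB : ∀ u, (∀ i, ‖u i‖ = r i) → ‖f u‖ ≤ B)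
    {u : ι → ℂ} (hu : ∀ i, ‖u i‖ ≤ r i) : ‖f u‖ ≤ B := by
  classical
  cases nonempty_fintype ι
  suffices key : ∀ (s : Finset ι) (u : ι → ℂ), (∀ i, ‖u i‖ ≤ r i) → (∀ i ∉ s, ‖u i‖ = r i) →
      ‖f u‖ ≤ B from key Finset.univ u hu (by simp)
  intro s
  induction s using Finset.induction_on with
  | empty => exact fun u _ h => hB u fun i => h i (Finset.notMem_empty i)
  | insert j s _ ih =>
    intro u hu hs
    have hdiff : Differentiable ℂ fun ζ : ℂ => f (Function.update u j ζ) :=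
      hf.comp fun ζ => (hasFDerivAt_update u ζ).differentiableAt
    have hmax := Complex.norm_le_of_forall_mem_frontier_norm_le (U := Metric.ball 0 (r j)) (C := B)
      Metric.isBounded_ball hdiff.diffContOnCl (fun ζ hζ => ?_) (z := u j) ?_
    · simpa only [Function.update_eq_self] using hmax
    · rw [frontier_ball _ (hr j).ne', mem_sphere_zero_iff_norm] at hζ
      refine ih _ (fun i => ?_) fun i hi => ?_
      · rcases eq_or_ne i j with rfl | hij
        · simp [hζ]
        · simpa [hij] using hu i
      · rcases eq_or_ne i j with rfl | hij
        · simp [hζ]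
        · simpa [hij] using hs i (by simp [hij, hi])
    · rw [closure_ball _ (hr j).ne', mem_closedBall_zero_iff]
      exact hu j

theorem norm_polynomial_eval_le_pow_mul {p : Polynomial ℂ} {m : ℕ} (hp : p.natDegree ≤ m) {S : ℝ}
    (hS : ∀ z, ‖z‖ = 1 → ‖p.eval z‖ ≤ S) {z : ℂ} (hz : 1 ≤ ‖z‖) :
    ‖p.eval z‖ ≤ ‖z‖ ^ m * S := by
  -- The maximum principle is applied to `ζ ^ m * p (1 / ζ)`, a polynomial in `ζ`.
  have hreflect {ζ : ℂ} (hζ : ζ ≠ 0) : (p.reflect m).eval ζ⁻¹ * ζ ^ m = p.eval ζ := by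
    let _ := invertibleOfNonzero hζ
    simpa using Polynomial.eval₂_reflect_mul_pow (RingHom.id ℂ) ζ m p hp
  have hz₀ : z ≠ 0 := norm_pos_iff.1 (one_pos.trans_le hz)
  have hmax : ‖(p.reflect m).eval z⁻¹‖ ≤ S := by
    refine Complex.norm_le_of_forall_mem_frontier_norm_le (U := Metric.ball 0 1)
      Metric.isBounded_ball (p.reflect m).differentiable.diffContOnCl (fun ζ hζ => ?_) ?_
    · rw [frontier_ball _ one_ne_zero, mem_sphere_zero_iff_norm] at hζ
      have hζ₀ : ζ ≠ 0 := norm_pos_iff.1 (hζ ▸ one_pos)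
      have hζS := hS ζ⁻¹ (by rw [norm_inv, hζ, inv_one])
      rw [← hreflect (inv_ne_zero hζ₀), inv_inv, norm_mul, norm_pow, norm_inv, hζ] at hζS
      simpa only [inv_one, one_pow, mul_one] using hζS
    · rw [closure_ball _ one_ne_zero, mem_closedBall_zero_iff, norm_inv]
      exact inv_le_one_of_one_le₀ hz
  rw [← hreflect hz₀, norm_mul, norm_pow, mul_comm]
  gcongr

variable {ι : Type*} [Fintype ι] {P : MvPolynomial ι ℂ} {m : ℕ} {S : ℝ}

theorem norm_mvPolynomial_eval_le_of_norm_le_one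
    (hS : ∀ u : ι → ℂ, (∀ i, ‖u i‖ = 1) → ‖P.eval u‖ ≤ S) {u : ι → ℂ} (hu : ‖u‖ ≤ 1) :
    ‖P.eval u‖ ≤ S :=
  norm_le_of_forall_mem_distinguishedBoundary
    (fun z => (AnalyticOnNhd.eval_mvPolynomial P z (Set.mem_univ z)).differentiableAt)
    (fun _ => one_pos) hS fun i => (norm_le_pi_norm u i).trans hu

theorem norm_mvPolynomial_eval_le_pow_mul (hP : P.totalDegree ≤ m)
    (hS : ∀ u : ι → ℂ, (∀ i, ‖u i‖ = 1) → ‖P.eval u‖ ≤ S) {u : ι → ℂ} (hu : 1 ≤ ‖u‖) :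
    ‖P.eval u‖ ≤ ‖u‖ ^ m * S := by
  -- The restriction of `P` to the complex line through `u`.
  let v : ι → ℂ := (‖u‖⁻¹ : ℂ) • u
  let p : Polynomial ℂ := P.aeval fun i => Polynomial.C (v i) * Polynomial.X
  have hv : ‖v‖ = 1 := by
    have hu₀ : ‖u‖ ≠ 0 := (one_pos.trans_le hu).ne'
    rw [norm_smul, norm_inv, Complex.norm_real, norm_norm, inv_mul_cancel₀ hu₀]
  have hp : p.natDegree ≤ m := by
    simpa only [mul_one] using
      MvPolynomial.aeval_natDegree_le P hP _ fun i =>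
        Polynomial.natDegree_C_mul_le (v i) _ |>.trans Polynomial.natDegree_X_le
  have heval (ζ : ℂ) : p.eval ζ = P.eval (ζ • v) := by
    have hC : (Polynomial.evalRingHom ζ).comp Polynomial.C = RingHom.id ℂ :=
      RingHom.ext fun _ => Polynomial.eval_C
    rw [← Polynomial.coe_evalRingHom, show p = P.aeval _ from rfl, MvPolynomial.aeval_def,
      MvPolynomial.hom_eval₂, Polynomial.algebraMap_eq, hC, MvPolynomial.eval₂_id]
    congr 2
    ext i
    rw [Polynomial.coe_evalRingHom, Polynomial.eval_C_mul, Polynomial.eval_X, Pi.smul_apply,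
      smul_eq_mul, mul_comm]
  have hpS (ζ : ℂ) (hζ : ‖ζ‖ = 1) : ‖p.eval ζ‖ ≤ S := by
    rw [heval]
    exact norm_mvPolynomial_eval_le_of_norm_le_one hS (by rw [norm_smul, hζ, hv, one_mul])
  have h := norm_polynomial_eval_le_pow_mul hp hpS (z := ‖u‖) (by simpa using hu)
  have hv' : (‖u‖ : ℂ) • v = u :=
    smul_inv_smul₀ (Complex.ofReal_ne_zero.2 (one_pos.trans_le hu).ne') u
  rwa [heval, hv', Complex.norm_real, norm_norm] at h

theorem norm_mvPolynomial_eval_sub_le (hm : m ≠ 0) (hP : P.totalDegree ≤ m)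
    (hS : ∀ u : ι → ℂ, (∀ i, ‖u i‖ = 1) → ‖P.eval u‖ ≤ S) {z w : ι → ℂ} (hz : ‖z‖ ≤ 1)
    (hzw : m * ‖w - z‖ < 1) :
    ‖P.eval w - P.eval z‖ ≤ 2 * Real.exp 1 * m * S * ‖w - z‖ := by
  have hm₀ : (0 : ℝ) < m := by positivity
  have hS₀ : 0 ≤ S := (norm_nonneg _).trans (hS 1 fun _ => norm_one)
  have hbound {u : ι → ℂ} (hu : ‖u‖ ≤ 1 + (m : ℝ)⁻¹) : ‖P.eval u‖ ≤ Real.exp 1 * S := by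
    rcases le_total ‖u‖ 1 with hu₁ | hu₁
    · exact (norm_mvPolynomial_eval_le_of_norm_le_one hS hu₁).trans
        (le_mul_of_one_le_left hS₀ (Real.one_le_exp zero_le_one))
    · refine (norm_mvPolynomial_eval_le_pow_mul hP hS hu₁).trans ?_
      gcongr
      exact (pow_le_pow_left₀ (norm_nonneg u) hu m).trans Real.one_add_inv_pow_le_exp
  have hmaps : Set.MapsTo (fun u => P.eval u) (Metric.ball z (m : ℝ)⁻¹)
      (Metric.closedBall (P.eval z) (2 * Real.exp 1 * S)) := by
    intro u hu
    have hPu := hbound (u := u) (by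
      linarith [norm_le_norm_add_norm_sub' u z, mem_ball_iff_norm.1 hu])
    have hPz := hbound (u := z) (hz.trans (by simp))
    rw [mem_closedBall_iff_norm]
    linarith [norm_sub_le (P.eval u) (P.eval z)]
  have hSchwarz := Complex.dist_le_div_mul_dist_of_mapsTo_ball
    (AnalyticOnNhd.eval_mvPolynomial P |>.differentiableOn.mono (Set.subset_univ _)) hmaps
    (z := w) (by rwa [mem_ball_iff_norm, ← mul_one (m : ℝ)⁻¹, lt_inv_mul_iff₀ hm₀])
  simpa only [dist_eq_norm, div_inv_eq_mul, mul_right_comm _ S] using hSchwarz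

/-- The point of the torus with arguments `2 * π * k i / N`. -/
noncomputable def torusGrid {N : ℕ} (k : ι → Fin N) : ι → Circle :=
  fun i => Circle.exp (2 * Real.pi * k i / N)

theorem exists_norm_exp_sub_circle_le {N : ℕ} (hN : N ≠ 0) (z : Circle) :
    ∃ k : Fin N, ‖(Circle.exp (2 * Real.pi * k / N) : ℂ) - z‖ ≤ 2 * Real.pi / N := by
  have hN₀ : (0 : ℝ) < N := by positivity
  obtain ⟨t, ht, hzt⟩ := Circle.periodic_exp.exists_mem_Ico₀ Real.two_pi_pos (Complex.arg z)
  rw [Circle.exp_arg] at hzt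
  have htN : 0 ≤ t * N / (2 * Real.pi) := by have := ht.1; positivity
  have hk_lt : ⌊t * N / (2 * Real.pi)⌋₊ < N := by
    rw [Nat.floor_lt htN, div_lt_iff₀ Real.two_pi_pos, mul_comm]
    exact mul_lt_mul_of_pos_left ht.2 hN₀
  refine ⟨⟨_, hk_lt⟩, ?_⟩
  set k := ⌊t * N / (2 * Real.pi)⌋₊
  have hk_le : 2 * Real.pi * k / N ≤ t := by
    rw [div_le_iff₀ hN₀, ← le_div_iff₀' Real.two_pi_pos]
    exact Nat.floor_le htN
  have hlt_k : t ≤ 2 * Real.pi * k / N + 2 * Real.pi / N := by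
    rw [← add_div, le_div_iff₀ hN₀, ← mul_add_one, ← div_le_iff₀' Real.two_pi_pos]
    exact (Nat.lt_floor_add_one _).le
  have hfactor : (Circle.exp (2 * Real.pi * k / N) : ℂ) - z =
      z * (Complex.exp (Complex.I * (2 * Real.pi * k / N - t : ℝ)) - 1) := by
    rw [mul_comm Complex.I, ← Circle.coe_exp, Circle.exp_sub, ← hzt, mul_sub_one, ← Circle.coe_mul,
      mul_div_cancel]
  rw [hfactor, norm_mul, Circle.norm_coe, one_mul]
  refine Real.norm_exp_I_mul_ofReal_sub_one_le.trans (abs_le.2 ⟨?_, ?_⟩)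
  · linarith
  · linarith [div_pos Real.two_pi_pos hN₀]

theorem exists_norm_torusGrid_sub_le {N : ℕ} (hN : N ≠ 0) (z : ι → Circle) :
    ∃ k : ι → Fin N,
      ‖(fun i => (torusGrid k i : ℂ)) - fun i => (z i : ℂ)‖ ≤ 2 * Real.pi / N := by
  choose k hk using fun i => exists_norm_exp_sub_circle_le hN (z i)
  exact ⟨k, (pi_norm_le_iff_of_nonneg (by positivity)).2 hk⟩

theorem norm_mvPolynomial_eval_le_two_mul_norm_grid [DecidableEq ι] (hm : m ≠ 0)
    (hP : P.totalDegree ≤ m) {N : ℕ} (hN : 8 * Real.pi * Real.exp 1 * m ≤ N) (z : ι → Circle) :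
    ‖P.eval fun i => (z i : ℂ)‖ ≤
      2 * ‖fun k : ι → Fin N => P.eval fun i => (torusGrid k i : ℂ)‖ := by
  have hm₀ : (0 : ℝ) < m := by positivity
  have hN₀ : (0 : ℝ) < N := lt_of_lt_of_le (by positivity) hN
  have hcont : Continuous fun z : ι → Circle => ‖P.eval fun i => (z i : ℂ)‖ :=
    (MvPolynomial.continuous_eval P).norm.comp (by fun_prop)
  obtain ⟨z₀, hz₀⟩ : ∃ z₀ : ι → Circle, ∀ z : ι → Circle,
      ‖P.eval fun i => (z i : ℂ)‖ ≤ ‖P.eval fun i => (z₀ i : ℂ)‖ := by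
    obtain ⟨z₀, -, hz₀⟩ := isCompact_univ.exists_isMaxOn Set.univ_nonempty hcont.continuousOn
    exact ⟨z₀, fun z => isMaxOn_iff.1 hz₀ z (Set.mem_univ z)⟩
  set S : ℝ := ‖P.eval fun i => (z₀ i : ℂ)‖
  have hS (u : ι → ℂ) (hu : ∀ i, ‖u i‖ = 1) : ‖P.eval u‖ ≤ S :=
    hz₀ fun i => ⟨u i, mem_sphere_zero_iff_norm.2 (hu i)⟩
  obtain ⟨k, hk⟩ := exists_norm_torusGrid_sub_le (by exact_mod_cast hN₀.ne') z₀
  set w : ι → ℂ := fun i => (torusGrid k i : ℂ)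
  have hstep : 4 * Real.exp 1 * m * (2 * Real.pi / N) ≤ 1 := by
    rw [mul_div_assoc', div_le_one hN₀]
    linarith
  have hlt : m * ‖w - fun i => (z₀ i : ℂ)‖ < 1 := by
    have hexp : 1 ≤ Real.exp 1 := Real.one_le_exp zero_le_one
    have hmul := mul_le_mul_of_nonneg_left hk hm₀.le
    nlinarith [norm_nonneg (w - fun i => (z₀ i : ℂ))]
  have hclose := norm_mvPolynomial_eval_sub_le hm hP hS
    ((pi_norm_le_iff_of_nonneg zero_le_one).2 fun i => (Circle.norm_coe (z₀ i)).le) hlt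
  have hgrid := norm_le_pi_norm (fun k : ι → Fin N => P.eval fun i => (torusGrid k i : ℂ)) k
  have hsub : ‖P.eval w - P.eval fun i => (z₀ i : ℂ)‖ ≤ S / 2 := by
    refine hclose.trans ?_
    calc 2 * Real.exp 1 * m * S * ‖w - fun i => (z₀ i : ℂ)‖
        ≤ 2 * Real.exp 1 * m * S * (2 * Real.pi / N) := by gcongr
      _ = 4 * Real.exp 1 * m * (2 * Real.pi / N) * (S / 2) := by ring
      _ ≤ S / 2 := mul_le_of_le_one_left (by positivity) hstep
  refine (hz₀ z).trans ?_
  linarith [norm_le_norm_add_norm_sub (P.eval w) (P.eval fun i => (z₀ i : ℂ))]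

end Polydisc

/-! ### Trigonometric polynomials on a compact abelian group -/

theorem sqrt_log_four_mul_le (N : ℕ) : √(Real.log (4 * N)) ≤ 2 * √(1 + Real.log N) := by
  rw [show (2 : ℝ) = √4 by rw [show (4 : ℝ) = 2 ^ 2 by norm_num, Real.sqrt_sq zero_le_two],
    ← Real.sqrt_mul zero_le_four]
  gcongr
  rcases N.eq_zero_or_pos with rfl | hN
  · simp
  rw [Real.log_mul four_ne_zero (by positivity)]
  linarith [Real.log_natCast_nonneg N, Real.log_le_sub_one_of_pos (zero_lt_four (α := ℝ))]

theorem four_le_exp_sq_mul_sqrt_two : 4 ≤ Real.exp 1 ^ 2 * √2 := by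
  have h : 1 ≤ √2 := Real.one_le_sqrt.2 one_le_two
  nlinarith [Real.exp_one_gt_d9]

section TrigPolynomial

variable {G : Type*} [CommGroup G] [TopologicalSpace G]

/-- A character of `G` as a complex valued continuous function. -/
noncomputable def characterMap (γ : PontryaginDual G) : C(G, ℂ) :=
  ⟨fun g => (γ g : ℂ), continuous_subtype_val.comp (map_continuous γ)⟩

theorem norm_characterMap_le [CompactSpace G] (γ : PontryaginDual G) : ‖characterMap γ‖ ≤ 1 :=
  (ContinuousMap.norm_le _ zero_le_one).2 fun g => (Circle.norm_coe (γ g)).le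

variable [IsTopologicalGroup G] [CompactSpace G] [MeasurableSpace G] [BorelSpace G]

theorem integral_character_eq_zero {γ : PontryaginDual G} (hγ : γ ≠ 1) :
    ∫ g, (γ g : ℂ) ∂(normalizedHaar G) = 0 := by
  have : (normalizedHaar G).IsMulLeftInvariant := by
    unfold normalizedHaar
    infer_instance
  obtain ⟨h, hh⟩ : ∃ h, γ h ≠ 1 := DFunLike.ne_iff.1 hγ
  have hinv := integral_mul_left_eq_self (μ := normalizedHaar G) (fun g => (γ g : ℂ)) h
  simp only [map_mul, Circle.coe_mul, integral_const_mul] at hinv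
  exact (mul_left_eq_self₀.1 hinv).resolve_left fun h₁ => hh (Circle.ext h₁)

open Classical in
theorem fourierCoefficient_characterMap (γ δ : PontryaginDual G) :
    fourierCoefficient γ (characterMap δ) = if γ = δ then 1 else 0 := by
  have hdiv : fourierCoefficient γ (characterMap δ) =
      ∫ g, ((δ / γ) g : ℂ) ∂(normalizedHaar G) := by
    refine integral_congr_ae (.of_forall fun g => ?_)
    change (δ g : ℂ) * (starRingEnd ℂ) (γ g : ℂ) = ((δ g / γ g : Circle) : ℂ)
    rw [div_eq_mul_inv, Circle.coe_mul, Circle.coe_inv_eq_conj]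
  rw [hdiv]
  split_ifs with hγ
  · rw [hγ, div_self']
    change ∫ _, ((1 : Circle) : ℂ) ∂(normalizedHaar G) = 1
    simp
  · exact integral_character_eq_zero fun h => hγ (div_eq_one.1 h).symm

variable (Γ : Finset (PontryaginDual G))

/-- A character in `Γ` as an element of `C_Γ`. -/
noncomputable def spectralCharacter (γ : Γ) : spectralSubspace Γ :=
  ⟨characterMap γ, fun δ hδ => by
    rw [fourierCoefficient_characterMap, if_neg (ne_of_mem_of_not_mem γ.2 hδ).symm]⟩

/-- The trigonometric polynomial `∑ γ, c γ • γ` with coefficients `c`, as an element of `C_Γ`. -/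
noncomputable def trigPolynomial : (Γ → ℂ) →ₗ[ℂ] spectralSubspace Γ :=
  Fintype.linearCombination ℂ (spectralCharacter Γ)

theorem trigPolynomial_eq_sum (c : Γ → ℂ) :
    trigPolynomial Γ c = ∑ γ, c γ • spectralCharacter Γ γ :=
  rfl

theorem trigPolynomial_apply (c : Γ → ℂ) (g : G) :
    (trigPolynomial Γ c : C(G, ℂ)) g = ∑ γ : Γ, c γ * ((γ : PontryaginDual G) g : ℂ) := by
  simp [trigPolynomial_eq_sum, spectralCharacter, characterMap]

theorem fourierCoefficient_trigPolynomial (c : Γ → ℂ) (γ : Γ) :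
    fourierCoefficient (γ : PontryaginDual G) (trigPolynomial Γ c) = c γ := by
  classical
  simp [trigPolynomial_eq_sum, spectralCharacter, fourierCoefficient_characterMap]

theorem sum_norm_mul_le_norm_multiplier_mul (ξ c : Γ → ℂ) :
    ∑ γ, ‖ξ γ * c γ‖ ≤ ‖multiplier Γ ξ‖ * ‖trigPolynomial Γ c‖ := by
  have hcoeff (γ : Γ) : multiplier Γ ξ (trigPolynomial Γ c) γ = ξ γ * c γ :=
    congrArg (ξ γ * ·) (fourierCoefficient_trigPolynomial Γ c γ)
  simpa only [PiLp.norm_eq_of_L1, hcoeff] using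
    (multiplier Γ ξ).le_opNorm (trigPolynomial Γ c)

theorem sum_norm_mul_le_of_norm_trigPolynomial_le {κ : Type*} [Fintype κ] {y : Γ → κ → ℂ}
    {A C : ℝ} (hA : 0 ≤ A) (hC : 0 ≤ C) (hy : ∀ γ, ‖y γ‖ ≤ A)
    (hnorm : ∀ c : Γ → ℂ, ‖trigPolynomial Γ c‖ ≤ C * ‖∑ γ, c γ • y γ‖)
    (ξ : Γ → ℂ) (μ : EuclideanSpace ℂ Γ) :
    ∑ γ, ‖ξ γ * μ γ‖ ≤
      C * (2 * (A * ‖μ‖) * √(Real.log (4 * Fintype.card κ))) * ‖multiplier Γ ξ‖ := by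
  obtain ⟨ε, hε⟩ := exists_signs_norm_sum_smul_le hA hC hy hnorm μ
  have hsign (e : ℤˣ) : ‖((e : ℤ) : ℂ)‖ = 1 := by
    rcases Int.units_eq_one_or e with rfl | rfl <;> simp
  calc ∑ γ, ‖ξ γ * μ γ‖ = ∑ γ, ‖ξ γ * ((ε γ : ℤ) * μ γ)‖ := by simp only [norm_mul, hsign, one_mul]
    _ ≤ ‖multiplier Γ ξ‖ * ‖trigPolynomial Γ fun γ => (ε γ : ℤ) * μ γ‖ :=
      sum_norm_mul_le_norm_multiplier_mul Γ ξ _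
    _ ≤ _ := by
      rw [mul_comm]
      gcongr
      exact hε

variable {Γ} in
theorem sum_norm_mul_le_of_isLambdaEmbedding {N : ℕ} {lam : ℝ}
    {I : spectralSubspace Γ →L[ℂ] (Fin N → ℂ)} (hI : IsLambdaEmbedding lam I) (ξ : Γ → ℂ)
    (μ : EuclideanSpace ℂ Γ) :
    ∑ γ, ‖ξ γ * μ γ‖ ≤
      Real.exp 1 ^ 2 * lam * √2 * (√(1 + Real.log N) * ‖multiplier Γ ξ‖) * ‖μ‖ := by
  obtain ⟨-, K, hK, hnorm, hIK⟩ := hI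
  have hy (γ : Γ) : ‖I (spectralCharacter Γ γ)‖ ≤ ‖I‖ :=
    I.unit_le_opNorm _ (norm_characterMap_le _)
  refine (sum_norm_mul_le_of_norm_trigPolynomial_le Γ (norm_nonneg I) hK hy (fun c => ?_)
    ξ μ).trans ?_
  · simpa only [trigPolynomial_eq_sum, map_sum, map_smul] using hnorm (trigPolynomial Γ c)
  calc K * (2 * (‖I‖ * ‖μ‖) * √(Real.log (4 * Fintype.card (Fin N)))) * ‖multiplier Γ ξ‖
      ≤ K * (2 * (‖I‖ * ‖μ‖) * (2 * √(1 + Real.log N))) * ‖multiplier Γ ξ‖ := by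
        rw [Fintype.card_fin]
        gcongr
        exact sqrt_log_four_mul_le N
    _ = 4 * (‖I‖ * K) * (√(1 + Real.log N) * ‖multiplier Γ ξ‖) * ‖μ‖ := by ring
    _ ≤ Real.exp 1 ^ 2 * √2 * lam * (√(1 + Real.log N) * ‖multiplier Γ ξ‖) * ‖μ‖ := by
        gcongr
        exact four_le_exp_sq_mul_sqrt_two
    _ = Real.exp 1 ^ 2 * lam * √2 * (√(1 + Real.log N) * ‖multiplier Γ ξ‖) * ‖μ‖ := by ring

end TrigPolynomial

/-! ### Analytic polynomials on the torus -/

section Torus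

variable {m n : ℕ}

theorem exists_monomialCharacter_eq {γ : PontryaginDual (Fin n → Circle)}
    (hγ : γ ∈ analyticSpectrum m n) :
    ∃ α : Fin n → ℕ, ∑ i, α i ≤ m ∧ monomialCharacter α = γ := by
  simp only [analyticSpectrum, Finset.mem_image, Finset.mem_filter] at hγ
  obtain ⟨α, ⟨-, hα⟩, rfl⟩ := hγ
  exact ⟨α, hα, rfl⟩

theorem coe_monomialCharacter_apply (α : Fin n → ℕ) (z : Fin n → Circle) :
    (monomialCharacter α z : ℂ) = ∏ i, (z i : ℂ) ^ α i := by
  change Circle.coeHom (∏ i, z i ^ α i) = _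
  simp only [map_prod, map_pow]
  rfl

theorem log_four_mul_card_grid_le (hm : m ≠ 0) (hn : n ≠ 0) :
    Real.log (4 * Fintype.card (Fin n → Fin ((1 + 20 * m) ^ 2))) ≤
      4 * (n * Real.log (1 + 20 * m)) := by
  have hm₁ : (1 : ℝ) ≤ m := by exact_mod_cast Nat.one_le_iff_ne_zero.2 hm
  have hn₁ : (1 : ℝ) ≤ n := by exact_mod_cast Nat.one_le_iff_ne_zero.2 hn
  have hlog₄ : Real.log 4 ≤ Real.log (1 + 20 * m) := Real.log_le_log zero_lt_four (by linarith)
  have hlog₀ : 0 ≤ Real.log (1 + 20 * m) := Real.log_nonneg (by linarith)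
  rw [Fintype.card_fun, Fintype.card_fin, Fintype.card_fin]
  push_cast
  rw [Real.log_mul four_ne_zero (by positivity), Real.log_pow, Real.log_pow]
  push_cast
  nlinarith

variable [MeasurableSpace (Fin n → Circle)] [BorelSpace (Fin n → Circle)]

theorem exists_mvPolynomial_eval_eq_trigPolynomial (c : analyticSpectrum m n → ℂ) :
    ∃ P : MvPolynomial (Fin n) ℂ, P.totalDegree ≤ m ∧ ∀ z : Fin n → Circle,
      (trigPolynomial (analyticSpectrum m n) c : C(Fin n → Circle, ℂ)) z =
        P.eval fun i => (z i : ℂ) := by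
  choose α hα hαγ using fun γ : analyticSpectrum m n => exists_monomialCharacter_eq γ.2
  refine ⟨∑ γ, MvPolynomial.monomial (Finsupp.equivFunOnFinite.symm (α γ)) (c γ),
    MvPolynomial.totalDegree_finsetSum_le fun γ _ => ?_, fun z => ?_⟩
  · refine (MvPolynomial.totalDegree_monomial_le _ _).trans ?_
    rw [Finsupp.sum_fintype _ _ fun _ => rfl]
    exact hα γ
  · rw [trigPolynomial_apply, map_sum]
    refine Finset.sum_congr rfl fun γ _ => ?_
    rw [MvPolynomial.eval_monomial, Finsupp.prod_fintype _ _ fun _ => pow_zero _, ← hαγ γ,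
      coe_monomialCharacter_apply]
    rfl

theorem norm_trigPolynomial_analyticSpectrum_le (hm : m ≠ 0) {N : ℕ}
    (hN : 8 * Real.pi * Real.exp 1 * m ≤ N) (c : analyticSpectrum m n → ℂ) :
    ‖trigPolynomial (analyticSpectrum m n) c‖ ≤ 2 * ‖∑ γ : analyticSpectrum m n,
      c γ • fun k : Fin n → Fin N =>
        ((γ : PontryaginDual (Fin n → Circle)) (torusGrid k) : ℂ)‖ := by
  obtain ⟨P, hP, hPc⟩ := exists_mvPolynomial_eval_eq_trigPolynomial c
  have hgrid : (∑ γ : analyticSpectrum m n, c γ • fun k : Fin n → Fin N =>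
      ((γ : PontryaginDual (Fin n → Circle)) (torusGrid k) : ℂ)) =
        fun k => P.eval fun i => (torusGrid k i : ℂ) := by
    funext k
    rw [← hPc, trigPolynomial_apply, Finset.sum_apply]
    rfl
  rw [hgrid]
  refine (ContinuousMap.norm_le _ (by positivity)).2 fun z => ?_
  refine (congrArg norm (hPc z)).trans_le ?_
  exact norm_mvPolynomial_eval_le_two_mul_norm_grid hm hP hN z

theorem sum_norm_mul_le_of_analyticSpectrum (hm : m ≠ 0) (hn : n ≠ 0)
    (ξ : analyticSpectrum m n → ℂ) (μ : EuclideanSpace ℂ (analyticSpectrum m n)) :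
    ∑ γ, ‖ξ γ * μ γ‖ ≤ 2 * Real.exp 1 ^ 2 * √2 *
      (√(n * Real.log (1 + 20 * m)) * ‖multiplier (analyticSpectrum m n) ξ‖) * ‖μ‖ := by
  set M : ℝ := ‖multiplier (analyticSpectrum m n) ξ‖
  have hgrid : 8 * Real.pi * Real.exp 1 * m ≤ ((1 + 20 * m) ^ 2 : ℕ) := by
    have hm₁ : (1 : ℝ) ≤ m := by exact_mod_cast Nat.one_le_iff_ne_zero.2 hm
    have hπe : Real.pi * Real.exp 1 ≤ 4 * 3 := by
      gcongr
      exacts [Real.pi_le_four, Real.exp_one_lt_three.le]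
    push_cast
    nlinarith
  have hcard := Real.sqrt_le_sqrt (log_four_mul_card_grid_le hm hn)
  rw [Real.sqrt_mul zero_le_four, show √(4 : ℝ) = 2 by
    rw [show (4 : ℝ) = 2 ^ 2 by norm_num, Real.sqrt_sq zero_le_two]] at hcard
  calc ∑ γ, ‖ξ γ * μ γ‖
      ≤ 2 * (2 * (1 * ‖μ‖) *
          √(Real.log (4 * Fintype.card (Fin n → Fin ((1 + 20 * m) ^ 2))))) * M :=
        sum_norm_mul_le_of_norm_trigPolynomial_le _ zero_le_one zero_le_two
          (fun γ => (pi_norm_le_iff_of_nonneg zero_le_one).2 fun k => (Circle.norm_coe _).le)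
          (norm_trigPolynomial_analyticSpectrum_le hm hgrid) ξ μ
    _ ≤ 2 * (2 * (1 * ‖μ‖) * (2 * √(n * Real.log (1 + 20 * m)))) * M := by gcongr
    _ = 2 * 4 * (√(n * Real.log (1 + 20 * m)) * M) * ‖μ‖ := by ring
    _ ≤ 2 * (Real.exp 1 ^ 2 * √2) * (√(n * Real.log (1 + 20 * m)) * M) * ‖μ‖ := by
        gcongr
        exact four_le_exp_sq_mul_sqrt_two
    _ = 2 * Real.exp 1 ^ 2 * √2 * (√(n * Real.log (1 + 20 * m)) * M) * ‖μ‖ := by ring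

end Torus

/-! ### Interpolation functors -/

section OperatorNorm

variable {V W : Type u} [AddCommGroup V] [Module ℂ V] [TopologicalSpace V]
  [AddCommGroup W] [Module ℂ W] [TopologicalSpace W]

theorem BanachSubspace.NormLE.mono {B : BanachSubspace V} {v : V} {c d : ℝ}
    (h : B.NormLE v c) (hcd : c ≤ d) : B.NormLE v d :=
  h.imp fun _ hx => ⟨hx.1, hx.2.trans hcd⟩

theorem BanachSubspace.NormLE.smul {B : BanachSubspace V} {v : V} {c : ℝ}
    (h : B.NormLE v c) (a : ℂ) : B.NormLE (a • v) (‖a‖ * c) := by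
  obtain ⟨x, rfl, hx⟩ := h
  exact ⟨a • x, map_smul B.incl a x, (norm_smul_le a x).trans (by gcongr)⟩

theorem BanachSubspace.normLE_incl_iff {B : BanachSubspace V} {x : B.carrier} {c : ℝ} :
    B.NormLE (B.incl x) c ↔ ‖x‖ ≤ c :=
  ⟨fun ⟨_, hy, hyc⟩ => B.incl_injective hy ▸ hyc, fun h => ⟨x, rfl, h⟩⟩

variable {S : Submodule ℂ V} {S' : Submodule ℂ W} {T : S →ₗ[ℂ] S'}
  {A : BanachSubspace V} {B : BanachSubspace W}

theorem operatorNorm_nonneg : 0 ≤ operatorNorm T A B :=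
  Real.sInf_nonneg fun _ hc => hc.1

theorem operatorNorm_le {c : ℝ} (hc : 0 ≤ c) (h : BoundedBy T A B c) : operatorNorm T A B ≤ c :=
  csInf_le ⟨0, fun _ hd => hd.1⟩ ⟨hc, h⟩

theorem boundedBy_operatorNorm (h : ∃ c, BoundedBy T A B c) :
    BoundedBy T A B (operatorNorm T A B) := by
  obtain ⟨c, hc⟩ := h
  intro x hx
  obtain ⟨y, hy, hyc⟩ := hc x hx
  rw [← hy, BanachSubspace.normLE_incl_iff]
  rcases (norm_nonneg x).eq_or_lt with hx₀ | hx₀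
  · simpa only [← hx₀, mul_zero] using hyc
  rw [← div_le_iff₀ hx₀]
  refine le_csInf ⟨|c|, abs_nonneg c, fun z hz => (hc z hz).mono ?_⟩ fun d hd => ?_
  · gcongr
    exact le_abs_self c
  · rw [div_le_iff₀ hx₀, ← BanachSubspace.normLE_incl_iff, hy]
    exact hd.2 x hx

end OperatorNorm

namespace InterpolationFunctor

variable {F : InterpolationFunctor.{u}} {X Y : BanachCouple.{u}} {s t : ℝ}

theorem incl_mem_sum (F : InterpolationFunctor.{u}) (x : (F.obj X).carrier) :
    (F.obj X).incl x ∈ X.sum := by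
  obtain ⟨_, hC⟩ := F.le_sum X
  obtain ⟨x₀, x₁, hx, -⟩ := hC x
  rw [hx]
  exact Submodule.add_mem_sup ⟨x₀, rfl⟩ ⟨x₁, rfl⟩

theorem fundamentalFunction_nonneg (F : InterpolationFunctor.{u}) (s t : ℝ) :
    0 ≤ F.fundamentalFunction s t := by
  refine Real.sSup_nonneg ?_
  rintro _ ⟨X, Y, T, -, -, rfl⟩
  exact operatorNorm_nonneg

theorem mapNorm_le_fundamentalFunction (hF : F.IsExact) (T : CoupleOperator X Y)
    (hs : T.norm₀ ≤ s) (ht : T.norm₁ ≤ t) : F.mapNorm T ≤ F.fundamentalFunction s t := by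
  refine le_csSup ⟨max s t, ?_⟩ ⟨X, Y, T, hs, ht, rfl⟩
  rintro _ ⟨X, Y, T, hs, ht, rfl⟩
  exact (hF X Y T).trans (max_le_max hs ht)

theorem normLE_map (hF : F.IsExact) (T : X.ambient →ₗ[ℂ] Y.ambient) (hs : 0 ≤ s) (ht : 0 ≤ t)
    (h₀ : ∀ x, Y.X₀.NormLE (T (X.X₀.incl x)) (s * ‖x‖))
    (h₁ : ∀ x, Y.X₁.NormLE (T (X.X₁.incl x)) (t * ‖x‖)) {v : X.ambient} {c : ℝ}
    (hv : (F.obj X).NormLE v c) : (F.obj Y).NormLE (T v) (F.fundamentalFunction s t * c) := by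
  have hmaps : ∀ x ∈ X.sum, T x ∈ Y.sum := by
    intro x hx
    obtain ⟨_, ⟨x₀, rfl⟩, _, ⟨x₁, rfl⟩, rfl⟩ := Submodule.mem_sup.1 hx
    obtain ⟨y₀, hy₀, -⟩ := h₀ x₀
    obtain ⟨y₁, hy₁, -⟩ := h₁ x₁
    rw [map_add]
    exact Submodule.add_mem_sup ⟨y₀, hy₀⟩ ⟨y₁, hy₁⟩
  have hb₀ : BoundedBy (T.restrict hmaps) X.X₀ Y.X₀ s := fun x _ => h₀ x
  have hb₁ : BoundedBy (T.restrict hmaps) X.X₁ Y.X₁ t := fun x _ => h₁ x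
  let U : CoupleOperator X Y := ⟨T.restrict hmaps, ⟨s, hb₀⟩, ⟨t, hb₁⟩⟩
  have hU : F.mapNorm U ≤ F.fundamentalFunction s t :=
    mapNorm_le_fundamentalFunction hF U (operatorNorm_le hs hb₀) (operatorNorm_le ht hb₁)
  obtain ⟨x, rfl, hx⟩ := hv
  refine (boundedBy_operatorNorm (F.bounded X Y U) x (F.incl_mem_sum x)).mono ?_
  exact mul_le_mul hU hx (norm_nonneg _) (F.fundamentalFunction_nonneg s t)

theorem normLE_map_of_mul (hF : F.IsExact) (T : X.ambient →ₗ[ℂ] Y.ambient) {R : ℝ} (hR : 0 < R)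
    (hs : 0 ≤ s) (ht : 0 ≤ t) (h₀ : ∀ x, Y.X₀.NormLE (T (X.X₀.incl x)) (R * s * ‖x‖))
    (h₁ : ∀ x, Y.X₁.NormLE (T (X.X₁.incl x)) (R * t * ‖x‖)) {v : X.ambient} {c : ℝ}
    (hv : (F.obj X).NormLE v c) :
    (F.obj Y).NormLE (T v) (R * F.fundamentalFunction s t * c) := by
  have hnorm : ‖(R : ℂ)‖ = R := Complex.norm_of_nonneg hR.le
  have hR₀ : (R : ℂ) ≠ 0 := Complex.ofReal_ne_zero.2 hR.ne'
  have hscale {r a : ℝ} : ‖(R : ℂ)⁻¹‖ * (R * r * a) = r * a := by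
    rw [norm_inv, hnorm, mul_assoc R, inv_mul_cancel_left₀ hR.ne']
  have hmap := (normLE_map hF ((R : ℂ)⁻¹ • T) hs ht
    (fun x => ((h₀ x).smul (R : ℂ)⁻¹).mono hscale.le)
    (fun x => ((h₁ x).smul (R : ℂ)⁻¹).mono hscale.le) hv).smul (R : ℂ)
  rwa [LinearMap.smul_apply, smul_inv_smul₀ hR₀, hnorm, ← mul_assoc] at hmap

theorem one_le_fundamentalFunction_one_one (hF : F.IsExact) : 1 ≤ F.fundamentalFunction 1 1 := by
  obtain ⟨C, hC⟩ := F.inter_le scalarCouple.{u}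
  obtain ⟨x, hx, -⟩ := hC (ULift.up (1 : ℂ) : ULift.{u} ℂ) (ULift.up (1 : ℂ) : ULift.{u} ℂ) rfl
  have hx₀ : x ≠ 0 := by
    rintro rfl
    rw [map_zero] at hx
    exact zero_ne_one (congrArg ULift.down hx)
  have hid := normLE_map hF (X := scalarCouple.{u}) (Y := scalarCouple.{u})
    LinearMap.id zero_le_one zero_le_one
    (fun z => ⟨z, rfl, (one_mul _).ge⟩) (fun z => ⟨z, rfl, (one_mul _).ge⟩)
    (BanachSubspace.normLE_incl_iff.2 (le_refl ‖x‖))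
  exact (le_mul_iff_one_le_left (norm_pos_iff.2 hx₀)).1 (BanachSubspace.normLE_incl_iff.1 hid)

theorem normLE_of_isNormalized (hF : F.IsExact) (hN : F.IsNormalized) {v : Y.ambient}
    (h₀ : Y.X₀.NormLE v s) (h₁ : Y.X₁.NormLE v t) :
    (F.obj Y).NormLE v (F.fundamentalFunction s t) := by
  have hs : 0 ≤ s := h₀.elim fun x hx => (norm_nonneg x).trans hx.2
  have ht : 0 ≤ t := h₁.elim fun x hx => (norm_nonneg x).trans hx.2
  let T : ULift.{u} ℂ →ₗ[ℂ] Y.ambient :=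
    (LinearMap.toSpanSingleton ℂ Y.ambient v).comp ULift.moduleEquiv.toLinearMap
  have hmap := normLE_map hF (X := scalarCouple.{u}) T hs ht
    (fun z => (h₀.smul z.down).mono (mul_comm _ _).le)
    (fun z => (h₁.smul z.down).mono (mul_comm _ _).le) hN
  have hT : T (ULift.up 1) = v := one_smul ℂ v
  exact hT ▸ hmap.mono (mul_one _).le

end InterpolationFunctor

section L1L2

/-- The Banach space `ℓ_p(ι)` inside `ℂ^ι`. -/
noncomputable def lpSubspace (p : ENNReal) [Fact (1 ≤ p)] (ι : Type u) [Fintype ι] :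
    BanachSubspace (ι → ℂ) :=
  ⟨PiLp p fun _ : ι => ℂ, PiLp.continuousLinearEquiv p ℂ fun _ : ι => ℂ,
    (PiLp.continuousLinearEquiv p ℂ fun _ : ι => ℂ).injective⟩

theorem normLE_lpSubspace_iff {p : ENNReal} [Fact (1 ≤ p)] {ι : Type u} [Fintype ι] {v : ι → ℂ}
    {c : ℝ} : (lpSubspace p ι).NormLE v c ↔ ‖WithLp.toLp p v‖ ≤ c :=
  BanachSubspace.normLE_incl_iff (B := lpSubspace p ι) (x := WithLp.toLp p v)

/-- The space `s B`, that is `B` with the norm `s ‖·‖_B`. It is encoded by keeping the norm of `B`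
and dividing the inclusion by `s`. -/
noncomputable def BanachSubspace.rescale {V : Type u} [AddCommGroup V] [Module ℂ V]
    [TopologicalSpace V] [ContinuousConstSMul ℂ V] (B : BanachSubspace V) {s : ℝ} (hs : s ≠ 0) :
    BanachSubspace V where
  carrier := B.carrier
  incl := (s : ℂ)⁻¹ • B.incl
  incl_injective :=
    (smul_right_injective V (inv_ne_zero (Complex.ofReal_ne_zero.2 hs))).comp B.incl_injective

theorem BanachSubspace.NormLE.rescale {V : Type u} [AddCommGroup V] [Module ℂ V]
    [TopologicalSpace V] [ContinuousConstSMul ℂ V] {B : BanachSubspace V} {v : V} {c : ℝ}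
    (h : B.NormLE v c) {s : ℝ} (hs : 0 < s) : (B.rescale hs.ne').NormLE v (s * c) := by
  obtain ⟨x, hx, hxc⟩ := h.smul (s : ℂ)
  refine ⟨x, ?_, hxc.trans_eq (by rw [Complex.norm_of_nonneg hs.le])⟩
  change (s : ℂ)⁻¹ • B.incl x = v
  rw [hx, inv_smul_smul₀ (Complex.ofReal_ne_zero.2 hs.ne')]

/-- The couple `(s ℓ₂(ι), ℓ₂(ι))`, through which multiplication operators from `ℓ₂(ι)` to
`F(ℓ₁(ι), ℓ₂(ι))` are factored. -/
noncomputable def weightedL2Couple (ι : Type u) [Fintype ι] {s : ℝ} (hs : s ≠ 0) :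
    BanachCouple.{u} where
  ambient := ι → ℂ
  X₀ := (lpSubspace 2 ι).rescale hs
  X₁ := lpSubspace 2 ι

theorem normLE_l1l2Couple_mul {F : InterpolationFunctor.{u}} (hF : F.IsExact)
    (hN : F.IsNormalized) {ι : Type u} [Fintype ι] (ξ : ι → ℂ) {s R M : ℝ} (hs : 0 < s)
    (hR : 1 ≤ R) (hM : 0 ≤ M)
    (h : ∀ x : EuclideanSpace ℂ ι, ∑ i, ‖ξ i * x i‖ ≤ R * (s * M) * ‖x‖)
    {μ : EuclideanSpace ℂ ι} (hμ : ‖μ‖ ≤ 1) :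
    (F.obj (l1l2Couple ι)).NormLE (fun i => ξ i * μ i)
      (R * F.fundamentalFunction M ‖ξ‖ * F.fundamentalFunction s 1) := by
  have hR₀ : 0 < R := one_pos.trans_le hR
  have hμ₁ : (lpSubspace 2 ι).NormLE μ 1 := normLE_lpSubspace_iff.2 hμ
  have hFμ : (F.obj (weightedL2Couple ι hs.ne')).NormLE (μ : ι → ℂ)
      (F.fundamentalFunction s 1) :=
    F.normLE_of_isNormalized hF hN ((hμ₁.rescale hs).mono (mul_one s).le) hμ₁
  refine InterpolationFunctor.normLE_map_of_mul hF (Y := l1l2Couple ι) (LinearMap.mulLeft ℂ ξ)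
    hR₀ hM (norm_nonneg ξ) (fun x => ?_) (fun x => ?_) hFμ
  · change EuclideanSpace ℂ ι at x
    change (lpSubspace 1 ι).NormLE (fun i => ξ i * ((s : ℂ)⁻¹ • x) i) _
    rw [normLE_lpSubspace_iff, PiLp.norm_eq_of_L1]
    refine (h ((s : ℂ)⁻¹ • x)).trans_eq ?_
    rw [norm_smul, norm_inv, Complex.norm_of_nonneg hs.le]
    exact (show R * (s * M) * (s⁻¹ * ‖x‖) = R * M * ‖x‖ by field_simp)
  · change EuclideanSpace ℂ ι at x
    change (lpSubspace 2 ι).NormLE (fun i => ξ i * x i) (R * ‖ξ‖ * ‖x‖)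
    rw [normLE_lpSubspace_iff, mul_assoc]
    exact (norm_toLp_two_mul_le ξ x).trans (le_mul_of_one_le_left (by positivity) hR)

end L1L2

/-! ### Multiplication operators on `ℓ₂(Γ)` -/

theorem one_le_exp_sq_mul_mul_sqrt_two {lam : ℝ} (hlam : 1 ≤ lam) :
    1 ≤ Real.exp 1 ^ 2 * lam * √2 := by
  nlinarith [four_le_exp_sq_mul_sqrt_two]

section Embedding

variable {G : Type*} [CommGroup G] [TopologicalSpace G] [IsTopologicalGroup G] [CompactSpace G]
  [MeasurableSpace G] [BorelSpace G] {Γ : Finset (PontryaginDual G)} {N : ℕ} {lam : ℝ}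
  {I : spectralSubspace Γ →L[ℂ] (Fin N → ℂ)}

theorem finiteLpNorm_mul_le_of_isLambdaEmbedding (hI : IsLambdaEmbedding lam I) (ξ : Γ → ℂ)
    {θ p : ℝ} (hθ₀ : 0 ≤ θ) (hθ₁ : θ ≤ 1) (hp : 1 / p = (1 - θ) + θ / 2)
    {μ : EuclideanSpace ℂ Γ} (hμ : ‖μ‖ ≤ 1) :
    finiteLpNorm p (fun γ => ξ γ * μ γ) ≤ Real.exp 1 ^ 2 * lam * √2 *
      (√(1 + Real.log N) * ‖multiplier Γ ξ‖) ^ (1 - θ) * ‖ξ‖ ^ θ := by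
  have hlam : 1 ≤ lam := hI.1
  refine finiteLpNorm_mul_le ξ hμ (one_le_exp_sq_mul_mul_sqrt_two hlam) (by positivity)
    ((sum_norm_mul_le_of_isLambdaEmbedding hI ξ μ).trans ?_) hθ₀ hθ₁ hp
  exact mul_le_of_le_one_right (by positivity) hμ

end Embedding

theorem normLE_mul_of_isLambdaEmbedding {G : Type u} [CommGroup G] [TopologicalSpace G]
    [IsTopologicalGroup G] [CompactSpace G] [MeasurableSpace G] [BorelSpace G]
    {Γ : Finset (PontryaginDual G)} {N : ℕ} {lam : ℝ}
    {I : spectralSubspace Γ →L[ℂ] (Fin N → ℂ)} (hI : IsLambdaEmbedding lam I) (ξ : Γ → ℂ)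
    {F : InterpolationFunctor.{u}} (hF : F.IsExact) (hN : F.IsNormalized)
    {μ : EuclideanSpace ℂ Γ} (hμ : ‖μ‖ ≤ 1) :
    (F.obj (l1l2Couple Γ)).NormLE (fun γ => ξ γ * μ γ)
      (Real.exp 1 ^ 2 * lam * √2 * F.fundamentalFunction ‖multiplier Γ ξ‖ ‖ξ‖ *
        F.fundamentalFunction (√(1 + Real.log N)) 1) := by
  have hs : 0 < √(1 + Real.log N) := by positivity
  have hR := one_le_exp_sq_mul_mul_sqrt_two hI.1
  have hsum := sum_norm_mul_le_of_isLambdaEmbedding hI ξ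
  exact normLE_l1l2Couple_mul hF hN ξ hs hR (norm_nonneg (multiplier Γ ξ)) hsum hμ

theorem finiteLpNorm_mul_le_of_analyticSpectrum {m n : ℕ} [MeasurableSpace (Fin n → Circle)]
    [BorelSpace (Fin n → Circle)] (hm : m ≠ 0) (hn : n ≠ 0) (ξ : analyticSpectrum m n → ℂ)
    {θ p : ℝ} (hθ₀ : 0 ≤ θ) (hθ₁ : θ ≤ 1) (hp : 1 / p = (1 - θ) + θ / 2)
    {μ : EuclideanSpace ℂ (analyticSpectrum m n)} (hμ : ‖μ‖ ≤ 1) :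
    finiteLpNorm p (fun γ => μ γ * ξ γ) ≤ 2 * Real.exp 1 ^ 2 * √2 *
      (√(n * Real.log (1 + 20 * m)) * ‖multiplier (analyticSpectrum m n) ξ‖) ^ (1 - θ) *
        ‖ξ‖ ^ θ := by
  have hC : 1 ≤ 2 * Real.exp 1 ^ 2 * √2 := by linarith [four_le_exp_sq_mul_sqrt_two]
  simp only [mul_comm (μ _)]
  refine finiteLpNorm_mul_le ξ hμ hC (by positivity)
    ((sum_norm_mul_le_of_analyticSpectrum hm hn ξ μ).trans ?_) hθ₀ hθ₁ hp
  exact mul_le_of_le_one_right (by positivity) hμ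

theorem mainTheorem7 :
    (∀ (G : Type u) [CommGroup G] [TopologicalSpace G] [IsTopologicalGroup G] [CompactSpace G]
        [T2Space G] [MeasurableSpace G] [BorelSpace G]
        (Γ : Finset (PontryaginDual G)) (N : ℕ) (lam : ℝ)
        (I : spectralSubspace Γ →L[ℂ] (Fin N → ℂ)) (_ : IsLambdaEmbedding lam I) (ξ : Γ → ℂ),
      (∀ F : InterpolationFunctor.{u}, F.IsExact → F.IsNormalized →
        ∀ μ : EuclideanSpace ℂ Γ, ‖μ‖ ≤ 1 →
          (F.obj (l1l2Couple Γ)).NormLE (fun γ => ξ γ * μ γ)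
            ((Real.exp 1 ^ 2 * lam * √2 * F.fundamentalFunction 1 1) *
              F.fundamentalFunction ‖multiplier Γ ξ‖ ‖ξ‖ *
              F.fundamentalFunction (√(1 + Real.log N)) 1)) ∧
      (∀ θ p : ℝ, 0 < θ → θ < 1 → 1 / p = (1 - θ) + θ / 2 →
        ∀ μ : EuclideanSpace ℂ Γ, ‖μ‖ ≤ 1 →
          finiteLpNorm p (fun γ => ξ γ * μ γ) ≤
            Real.exp 1 ^ 2 * lam * √2 *
              (√(1 + Real.log N) * ‖multiplier Γ ξ‖) ^ (1 - θ) * ‖ξ‖ ^ θ)) ∧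
    (∀ (m n : ℕ) [MeasurableSpace (Fin n → Circle)] [BorelSpace (Fin n → Circle)],
      1 ≤ m → 1 ≤ n → ∀ ξ : analyticSpectrum m n → ℂ,
      (∀ θ p : ℝ, 0 < θ → θ < 1 → 1 / p = (1 - θ) + θ / 2 →
        ∀ μ : EuclideanSpace ℂ (analyticSpectrum m n), ‖μ‖ ≤ 1 →
          finiteLpNorm p (fun γ => μ γ * ξ γ) ≤
            2 * Real.exp 1 ^ 2 * √2 *
              (√(n * Real.log (1 + 20 * m)) * ‖multiplier (analyticSpectrum m n) ξ‖) ^ (1 - θ) *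
              ‖ξ‖ ^ θ) ∧
      (∀ μ : EuclideanSpace ℂ (analyticSpectrum m n), ‖μ‖ ≤ 1 →
          finiteLpNorm (2 * m / (m + 1)) (fun γ => μ γ * ξ γ) ≤
            2 * Real.exp 1 ^ 2 * √2 *
              (√(n * Real.log (1 + 20 * m)) * ‖multiplier (analyticSpectrum m n) ξ‖) ^
                (1 / (m : ℝ)) *
              ‖ξ‖ ^ (1 - 1 / (m : ℝ)))) := by
  refine ⟨fun G _ _ _ _ _ _ _ Γ N lam I hI ξ => ⟨fun F hF hN μ hμ => ?_,
    fun θ p hθ₀ hθ₁ hp μ hμ => ?_⟩, fun m n _ _ hm hn ξ => ⟨fun θ p hθ₀ hθ₁ hp μ hμ => ?_,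
    fun μ hμ => ?_⟩⟩
  · have hlam : 1 ≤ lam := hI.1
    have hψ := F.fundamentalFunction_nonneg
    refine (normLE_mul_of_isLambdaEmbedding hI ξ hF hN hμ).mono ?_
    refine mul_le_mul_of_nonneg_right (mul_le_mul_of_nonneg_right ?_ (hψ _ _)) (hψ _ _)
    exact le_mul_of_one_le_right (by positivity)
      (InterpolationFunctor.one_le_fundamentalFunction_one_one hF)
  · exact finiteLpNorm_mul_le_of_isLambdaEmbedding hI ξ hθ₀.le hθ₁.le hp hμ
  · exact finiteLpNorm_mul_le_of_analyticSpectrum (by lia) (by lia) ξ hθ₀.le hθ₁.le hp hμ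
  · have hm₁ : (1 : ℝ) ≤ m := by exact_mod_cast hm
    simpa only [sub_sub_cancel] using
      finiteLpNorm_mul_le_of_analyticSpectrum (by lia) (by lia) ξ
        (θ := 1 - 1 / (m : ℝ)) (p := 2 * m / (m + 1))
        (sub_nonneg.2 ((div_le_one (by linarith)).2 hm₁)) (sub_le_self 1 (by positivity))
        (by field_simp; ring) hμ
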